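/- Let $\mathbb K$ be $\mathbb R$ or $\mathbb C$, and let $E$ and $F$ be normed spaces over $\mathbb K$ with $E$ finite-dimensional. A bijective additive map $T$ between two spaces of functions is called biseparating if, for all $f,g$ in its domain, the sets $\{f\neq 0\}$ and $\{g\neq 0\}$ are disjoint if and only if $\{Tf\neq 0\}$ and $\{Tg\neq 0\}$ are disjoint. (a) Let $X$ and $Y$ be completely regular topological spaces, and let $C_b(X,E)$ and $C_b(Y,F)$ be the spaces of bounded continuous functions from $X$ to $E$ and from $Y$ to $F$, with the sup norm. If $T\colon C_b(X,E)\to C_b(Y,F)$ is a $\mathbb K$-linear biseparating bijection, then $T$ and $T^{-1}$ are continuous. (b) Let $X$ and $Y$ be complete metric spaces, and let $C_b^u(X,E)$ and $C_b^u(Y,F)$ be the spaces of bounded uniformly continuous functions from $X$ to $E$ and from $Y$ to $F$, with the sup norm. If $T\colon C_b^u(X,E)\to C_b^u(Y,F)$ is a $\mathbb K$-linear biseparating bijection, then $T$ and $T^{-1}$ are continuous. -/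

import Mathlib

open scoped BoundedContinuousFunction

namespace SepMaps

/-- The space of bounded uniformly continuous functions `X → E`, as a subspace of the bounded
continuous functions; it inherits the sup norm from `X →ᵇ E`. -/
def Cbu (𝕜 X E : Type*) [RCLike 𝕜] [MetricSpace X] [NormedAddCommGroup E] [NormedSpace 𝕜 E] :
    Submodule 𝕜 (X →ᵇ E) where
  carrier := {f | UniformContinuous f}
  add_mem' hf hg := UniformContinuous.add hf hg
  zero_mem' := uniformContinuous_const
  smul_mem' c _ hf := UniformContinuous.const_smul hf c

/-- Elements of `Cbu 𝕜 X E` are functions from `X` to `E`. -/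
instance instFunLikeCbu (𝕜 X E : Type*) [RCLike 𝕜] [MetricSpace X] [NormedAddCommGroup E]
    [NormedSpace 𝕜 E] : FunLike (Cbu 𝕜 X E) X E where
  coe f := fun x => (f : X →ᵇ E) x
  coe_injective _ _ h := Subtype.ext (DFunLike.coe_injective h)

/-- A map `T` between spaces of functions is separating if it is additive and maps functions with
disjoint cozero sets to functions with disjoint cozero sets. The cozero set `{x | f x ≠ 0}` of `f`
is `Function.support f`. -/
def IsSeparating {A B X Y E F : Type*} [FunLike A X E] [FunLike B Y F] [Zero E] [Zero F]
    [Add A] [Add B] (T : A → B) : Prop :=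
  (∀ f g : A, T (f + g) = T f + T g) ∧
  ∀ f g : A, Disjoint (Function.support f) (Function.support g) →
    Disjoint (Function.support (T f)) (Function.support (T g))

/-- A bijection `T` between spaces of functions is biseparating if `T` and its inverse are
separating. -/
def IsBiseparating {A B X Y E F : Type*} [FunLike A X E] [FunLike B Y F] [Zero E] [Zero F]
    [Add A] [Add B] (T : A ≃ B) : Prop :=
  IsSeparating T ∧ IsSeparating T.symm

end SepMaps

open Set Filter Topology Function

namespace SepMaps

/-! Each `y` has an ultrafilter `p` on `X` containing the closed support of every `f` with `T f y ≠
0`. The key fact is that `T u y = 0` whenever `u` tends to `0` along `p`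
(`apply_eq_zero_of_tendsto`). Since `E` is finite-dimensional, a bounded `f` has a limit `e` along
`p`, so `T f y` is the value at `y` of `T` applied to the constant `e`, a linear function of `e`.
Hence evaluations of `T f` are continuous, and the closed graph theorem applies.

For the key fact, split `u` by `sin² + cos² = 1` in the variable `t = ‖u‖ ^ (-1/2)`. Each part is a
sum of disjoint humps `h k`. Weighting the `k`-th hump by `k` keeps the function bounded and
continuous, but multiplies its image by `k` where `T (h k) ≠ 0`. If the image of the part were
nonzero at `y`, arbitrarily large `k` would occur near `y`, contradicting boundedness. -/

/-- Every point has, inside every neighbourhood, bumps from `A` with arbitrary value there. -/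
def HasBumps {𝕜 X E : Type*} [RCLike 𝕜] [TopologicalSpace X] [NormedAddCommGroup E]
    [NormedSpace 𝕜 E] (A : Submodule 𝕜 (X →ᵇ E)) : Prop :=
  ∀ (U : Set X) (x : X) (v : E), IsOpen U → x ∈ U → ∃ f : A, f.1 x = v ∧ ∀ z, z ∉ U → f.1 z = 0

lemma disjoint_support_iff_forall {X E : Type*} [Zero E] {f g : X → E} :
    Disjoint (support f) (support g) ↔ ∀ x, f x = 0 ∨ g x = 0 := by
  simp [Set.disjoint_left, or_iff_not_imp_left]

/-- `A` is stable under applying continuous functions of two variables. -/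
def StableUnderComp {𝕜 X E : Type*} [RCLike 𝕜] [TopologicalSpace X] [NormedAddCommGroup E]
    [NormedSpace 𝕜 E] (A : Submodule 𝕜 (X →ᵇ E)) : Prop :=
  ∀ (f g : A) (G : E × E → E), Continuous G → ∃ h : A, ∀ x, h.1 x = G (f.1 x, g.1 x)

/-- `T` maps functions with disjoint cozero sets to functions with disjoint cozero sets. -/
def PreservesDisjointness {𝕜 X Y E F : Type*} [RCLike 𝕜] [TopologicalSpace X] [TopologicalSpace Y]
    [NormedAddCommGroup E] [NormedSpace 𝕜 E] [NormedAddCommGroup F] [NormedSpace 𝕜 F]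
    {A : Submodule 𝕜 (X →ᵇ E)} {B : Submodule 𝕜 (Y →ᵇ F)} (T : A ≃ₗ[𝕜] B) : Prop :=
  ∀ f g : A, (∀ x, f.1 x = 0 ∨ g.1 x = 0) → ∀ y, (T f).1 y = 0 ∨ (T g).1 y = 0

/-! ### Oscillating radial multipliers on `E` -/

section Hump

/-- As `⌊t⌋ = t - fract t` and `sin² (π t)` has period one, only `s * sin² (π s)` at `s = fract t`
matters; it vanishes at both `0` and `1`, so it glues continuously. -/
lemma continuous_floor_mul_sin_sq :
    Continuous fun t : ℝ => (⌊t⌋ : ℝ) * Real.sin (Real.pi * t) ^ 2 := by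
  have hper : ∀ t : ℝ, Real.sin (Real.pi * t) ^ 2 = Real.sin (Real.pi * Int.fract t) ^ 2 := by
    intro t
    have : Real.pi * Int.fract t = Real.pi * t - ⌊t⌋ * Real.pi := by
      rw [Int.fract]; ring
    rw [this, Real.sin_sub_int_mul_pi, mul_pow, ← sq_abs ((-1 : ℝ) ^ ⌊t⌋), abs_zpow,
      abs_neg, abs_one, one_zpow, one_pow, one_mul]
  have h1 : Continuous ((fun s : ℝ => s * Real.sin (Real.pi * s) ^ 2) ∘ Int.fract) := by
    refine ContinuousOn.comp_fract'' (by fun_prop) (by simp)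
  have h2 : Continuous fun t : ℝ => t * Real.sin (Real.pi * t) ^ 2 := by fun_prop
  refine (h2.sub h1).congr fun t => ?_
  change t * Real.sin (Real.pi * t) ^ 2 - Int.fract t * Real.sin (Real.pi * Int.fract t) ^ 2 = _
  rw [← hper, ← sub_mul, Int.self_sub_fract]

/-- The hump of `sin² (π t)` over `[k, k + 1]`. -/
noncomputable def sinHump (k : ℤ) (t : ℝ) : ℝ :=
  Real.sin (Real.pi * max (k : ℝ) (min t (k + 1))) ^ 2

lemma continuous_sinHump (k : ℤ) : Continuous (sinHump k) := by
  unfold sinHump; fun_prop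

lemma sinHump_floor (t : ℝ) : sinHump ⌊t⌋ t = Real.sin (Real.pi * t) ^ 2 := by
  rw [sinHump, min_eq_left (Int.lt_floor_add_one t).le, max_eq_right (Int.floor_le t)]

lemma floor_eq_of_sinHump_ne_zero {k : ℤ} {t : ℝ} (h : sinHump k t ≠ 0) : ⌊t⌋ = k := by
  rw [Int.floor_eq_iff]
  by_contra hc
  apply h
  rw [not_and_or, not_le, not_lt] at hc
  rcases hc with hc | hc
  · rw [sinHump, max_eq_left ((min_le_left _ _).trans hc.le), mul_comm, Real.sin_int_mul_pi]
    simp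
  · have : Real.pi * ((k : ℝ) + 1) = ((k + 1 : ℤ) : ℝ) * Real.pi := by push_cast; ring
    rw [sinHump, min_eq_right hc, max_eq_right (by linarith), this, Real.sin_int_mul_pi]
    simp

variable {𝕜 E : Type*} [RCLike 𝕜] [NormedAddCommGroup E] [NormedSpace 𝕜 E]

/-- Multiplication of `e` by `a ((√‖e‖)⁻¹)`. -/
noncomputable def radialMul (𝕜 : Type*) {E : Type*} [RCLike 𝕜] [NormedAddCommGroup E]
    [NormedSpace 𝕜 E] (a : ℝ → ℝ) (e : E) : E :=
  ((a (√‖e‖)⁻¹ : ℝ) : 𝕜) • e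

/-- The square root leaves room for linear growth of `a`: near `0` the product is at most `C * (‖e‖
+ √‖e‖)`. -/
lemma continuous_radialMul {a : ℝ → ℝ} (ha : Continuous a) {C : ℝ}
    (hC : ∀ t, 0 ≤ t → |a t| ≤ C * (1 + t)) : Continuous (radialMul 𝕜 a : E → E) := by
  rw [continuous_iff_continuousAt]
  intro e
  by_cases he : e = 0
  · subst he
    have h0 : radialMul 𝕜 a (0 : E) = 0 := by simp [radialMul]
    rw [ContinuousAt, h0]
    have hlim : Tendsto (fun e : E => C * (‖e‖ + √‖e‖)) (𝓝 0) (𝓝 0) := by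
      have : Continuous fun e : E => C * (‖e‖ + √‖e‖) := by fun_prop
      simpa using this.tendsto 0
    refine squeeze_zero_norm (fun e => ?_) hlim
    rw [radialMul, norm_smul, RCLike.norm_ofReal]
    calc |a (√‖e‖)⁻¹| * ‖e‖ ≤ C * (1 + (√‖e‖)⁻¹) * ‖e‖ := by
          gcongr; exact hC _ (by positivity)
      _ = C * (‖e‖ + (√‖e‖)⁻¹ * ‖e‖) := by ring
      _ = C * (‖e‖ + √‖e‖) := by
          congr 2
          rw [inv_mul_eq_div, Real.div_sqrt]
  · have h1 : ContinuousAt (fun e : E => (√‖e‖)⁻¹) e := by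
      refine ContinuousAt.inv₀ (by fun_prop) ?_
      rw [Real.sqrt_ne_zero (norm_nonneg e)]
      simpa using he
    exact (RCLike.continuous_ofReal.continuousAt.comp
      (ha.continuousAt.comp h1)).smul continuousAt_id

lemma radialMul_eq_zero {a : ℝ → ℝ} {e : E} :
    radialMul 𝕜 a e = 0 ↔ a (√‖e‖)⁻¹ = 0 ∨ e = 0 := by
  simp [radialMul, smul_eq_zero]

end Hump

/-! ### Support ultrafilters and automatic continuity -/

section General

variable {𝕜 X Y E F : Type*} [RCLike 𝕜] [TopologicalSpace X] [TopologicalSpace Y]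
  [NormedAddCommGroup E] [NormedSpace 𝕜 E] [NormedAddCommGroup F] [NormedSpace 𝕜 F]
  {A : Submodule 𝕜 (X →ᵇ E)} {B : Submodule 𝕜 (Y →ᵇ F)} {T : A ≃ₗ[𝕜] B}

lemma StableUnderComp.exists_comp (hA : StableUnderComp A) (f : A) {G : E → E}
    (hG : Continuous G) : ∃ h : A, ∀ x, h.1 x = G (f.1 x) :=
  hA f f (fun q => G q.1) (hG.comp continuous_fst)

lemma StableUnderComp.const_mem (hA : StableUnderComp A) (e : E) :
    BoundedContinuousFunction.const X e ∈ A := by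
  obtain ⟨h, hh⟩ := hA.exists_comp 0 (continuous_const (y := e))
  convert h.2
  ext x
  exact (hh x).symm

/-- If the cozero set of `T k` lies in that of `T f`, then the cozero set of `k` lies in the
closure of that of `f`. -/
lemma support_subset_closure [Nontrivial E] (hbA : HasBumps A) (hT : PreservesDisjointness T)
    (hS : PreservesDisjointness T.symm) {f k : A} (h : ∀ y, (T f).1 y = 0 → (T k).1 y = 0) :
    support k.1 ⊆ closure (support f.1) := by
  intro x hx
  by_contra hc
  obtain ⟨v, hv⟩ := exists_ne (0 : E)
  obtain ⟨b, hb, hb0⟩ := hbA _ x v isClosed_closure.isOpen_compl hc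
  have hbf : ∀ z, b.1 z = 0 ∨ f.1 z = 0 := by
    intro z
    by_cases hz : z ∈ closure (support f.1)
    · exact .inl (hb0 z (by simpa using hz))
    · exact .inr (by simpa using fun h' => hz (subset_closure h'))
  have hbk : ∀ y, (T b).1 y = 0 ∨ (T k).1 y = 0 := fun y => (hT b f hbf y).imp_right (h y)
  have := hS (T b) (T k) hbk x
  simp only [LinearEquiv.symm_apply_apply] at this
  rcases this with h1 | h1
  · exact hv (hb ▸ h1)
  · exact hx h1

lemma exists_apply_ne_zero [Nontrivial F] (hbB : HasBumps B) (T : A ≃ₗ[𝕜] B) {U : Set Y} {y : Y}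
    (hU : IsOpen U) (hy : y ∈ U) : ∃ f : A, (T f).1 y ≠ 0 ∧ ∀ z, z ∉ U → (T f).1 z = 0 := by
  obtain ⟨v, hv⟩ := exists_ne (0 : F)
  obtain ⟨b, hb, hb0⟩ := hbB U y v hU hy
  refine ⟨T.symm b, ?_, ?_⟩
  · simpa [hb] using hv
  · simpa using hb0

/-- The filter on `X` generated by the closed supports of the functions `f` with `T f y ≠ 0`. -/
def supportFilter [Nontrivial E] [Nontrivial F] (hbA : HasBumps A) (hbB : HasBumps B)
    (hT : PreservesDisjointness T) (hS : PreservesDisjointness T.symm) (y : Y) : Filter X where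
  sets := {s | ∃ f : A, (T f).1 y ≠ 0 ∧ closure (support f.1) ⊆ s}
  univ_sets := by
    obtain ⟨f, hf, -⟩ := exists_apply_ne_zero hbB T isOpen_univ (mem_univ y)
    exact ⟨f, hf, subset_univ _⟩
  sets_of_superset := by
    rintro s t ⟨f, hf, hs⟩ hst
    exact ⟨f, hf, hs.trans hst⟩
  inter_sets := by
    rintro s t ⟨f, hf, hs⟩ ⟨g, hg, ht⟩
    obtain ⟨k, hk, hk0⟩ := exists_apply_ne_zero hbB T
      (U := {z | (T f).1 z ≠ 0} ∩ {z | (T g).1 z ≠ 0}) (y := y)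
      ((isOpen_ne_fun (T f).1.continuous continuous_const).inter
        (isOpen_ne_fun (T g).1.continuous continuous_const)) ⟨hf, hg⟩
    refine ⟨k, hk, subset_inter (Subset.trans ?_ hs) (Subset.trans ?_ ht)⟩ <;>
    refine closure_minimal (support_subset_closure hbA hT hS fun z hz => hk0 z ?_)
      isClosed_closure
    · exact fun h => h.1 hz
    · exact fun h => h.2 hz

/-- The support filter is proper because `T f y ≠ 0` forces `f ≠ 0`. Refining it to an ultrafilter
provides limits of bounded `E`-valued functions. -/
lemma exists_ultrafilter [Nontrivial E] [Nontrivial F] (hbA : HasBumps A) (hbB : HasBumps B)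
    (hT : PreservesDisjointness T) (hS : PreservesDisjointness T.symm) (y : Y) :
    ∃ p : Ultrafilter X, ∀ f : A, (T f).1 y ≠ 0 → closure (support f.1) ∈ p := by
  have : (supportFilter hbA hbB hT hS y).NeBot := by
    rw [neBot_iff, ne_eq, ← empty_mem_iff_bot]
    rintro ⟨f, hf, h⟩
    have h0 : support f.1 = ∅ := subset_empty_iff.1 (subset_closure.trans h)
    have : f = 0 := by
      ext x
      exact congrFun (support_eq_empty_iff.1 h0) x
    exact hf (by simp [this])
  obtain ⟨p, hp⟩ := Ultrafilter.exists_le (supportFilter hbA hbB hT hS y)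
  exact ⟨p, fun f hf => hp ⟨f, hf, Subset.rfl⟩⟩

variable {y : Y} {p : Ultrafilter X} {u : A}

lemma apply_eq_zero_of_norm_ge (hp : ∀ f : A, (T f).1 y ≠ 0 → closure (support f.1) ∈ p)
    (hu : Tendsto u.1 p (𝓝 0)) {ε : ℝ} (hε : 0 < ε) {f : A}
    (hf : ∀ x, f.1 x ≠ 0 → ε ≤ ‖u.1 x‖) : (T f).1 y = 0 := by
  by_contra hc
  have h1 : {x | ε ≤ ‖u.1 x‖} ∈ p := mem_of_superset (hp f hc) <| closure_minimal hf
    (isClosed_le continuous_const u.1.continuous.norm)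
  have h2 : {x | ‖u.1 x‖ < ε} ∈ p := by
    have := hu.norm.eventually_lt_const (u := ε) (by simpa using hε)
    exact this
  obtain ⟨x, hx1, hx2⟩ := p.nonempty_of_mem (inter_mem h1 h2)
  rw [mem_ofPred_eq] at hx1 hx2
  exact hx2.not_ge hx1

/-- Near `y`, the functions `T f` with `f` living where `‖u‖ ≥ ε` vanish, uniformly in `f`. -/
lemma exists_nhd_apply_eq_zero [Nontrivial F] (hA : StableUnderComp A) (hbB : HasBumps B)
    (hT : PreservesDisjointness T)
    (hp : ∀ f : A, (T f).1 y ≠ 0 → closure (support f.1) ∈ p)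
    (hu : Tendsto u.1 p (𝓝 0)) {ε : ℝ} (hε : 0 < ε) :
    ∃ W : Set Y, IsOpen W ∧ y ∈ W ∧
      ∀ f : A, (∀ x, f.1 x ≠ 0 → ε ≤ ‖u.1 x‖) → ∀ z ∈ W, (T f).1 z = 0 := by
  obtain ⟨g, hg, -⟩ := exists_apply_ne_zero hbB T isOpen_univ (mem_univ y)
  -- This cutoff is `1` up to `ε / 2` and `0` from `ε` on. So `g - h` lives where `‖u‖ ≥ ε / 2`,
  -- giving `T h y = T g y ≠ 0`, while `h` is disjoint from every admissible `f`.
  set φ : ℝ → ℝ := fun t => min 1 (max 0 (2 - 2 * t / ε)) with hφ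
  obtain ⟨h, hh⟩ := hA u g (fun q => ((φ ‖q.1‖ : ℝ) : 𝕜) • q.2)
    ((RCLike.continuous_ofReal.comp (by fun_prop)).smul continuous_snd)
  have h1 : (T (g - h)).1 y = 0 := by
    refine apply_eq_zero_of_norm_ge hp hu (half_pos hε) fun x hx => ?_
    by_contra! hc
    refine hx ?_
    have : φ ‖u.1 x‖ = 1 := by
      refine min_eq_left (le_max_of_le_right ?_)
      have : 2 * ‖u.1 x‖ / ε ≤ 1 := by rw [div_le_one hε]; linarith
      linarith
    simp [hh, this]
  have h2 : (T h).1 y ≠ 0 := by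
    simp only [map_sub, Submodule.coe_sub, BoundedContinuousFunction.coe_sub, Pi.sub_apply,
      sub_eq_zero] at h1
    rwa [← h1]
  refine ⟨{z | (T h).1 z ≠ 0}, isOpen_ne_fun (T h).1.continuous continuous_const, h2,
    fun f hf z hz => (hT f h (fun x => ?_) z).resolve_right hz⟩
  rw [or_iff_not_imp_left]
  intro hx
  have : φ ‖u.1 x‖ = 0 := by
    have : (2 : ℝ) ≤ 2 * ‖u.1 x‖ / ε := by
      rw [le_div_iff₀ hε]; linarith [hf x hx]
    simp [hφ, max_eq_left (sub_nonpos.2 this)]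
  simp [hh, this]

lemma hump_apply_eq_zero [Nontrivial F] (hA : StableUnderComp A) (hbB : HasBumps B)
    (hT : PreservesDisjointness T) (hS : PreservesDisjointness T.symm)
    (hp : ∀ f : A, (T f).1 y ≠ 0 → closure (support f.1) ∈ p)
    (hu : Tendsto u.1 p (𝓝 0)) {c : ℝ} (hc0 : 0 ≤ c) (hc1 : c ≤ 1) {f : A}
    (hf : ∀ x, f.1 x = radialMul 𝕜 (fun t => Real.sin (Real.pi * (t + c)) ^ 2) (u.1 x)) :
    (T f).1 y = 0 := by
  by_contra hy
  -- `g` equals `k • f` on the `k`-th hump.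
  obtain ⟨g, hg⟩ := hA.exists_comp u (G := radialMul 𝕜 fun t =>
      (⌊t + c⌋ : ℝ) * Real.sin (Real.pi * (t + c)) ^ 2)
    (continuous_radialMul (C := 1)
      (continuous_floor_mul_sin_sq.comp (continuous_id.add continuous_const)) fun t ht => by
        have h0 : (0 : ℝ) ≤ ⌊t + c⌋ := by exact_mod_cast Int.floor_nonneg.2 (by positivity)
        rw [abs_mul, abs_of_nonneg h0, abs_of_nonneg (sq_nonneg _), one_mul]
        calc _ ≤ (⌊t + c⌋ : ℝ) * 1 := by gcongr; exact Real.sin_sq_le_one _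
          _ ≤ 1 + t := by linarith [Int.floor_le (t + c)])
  have hpiece : ∀ k : ℤ, ∃ h : A, ∀ x, h.1 x =
      radialMul 𝕜 (fun t => sinHump k (t + c)) (u.1 x) := fun k => by
    refine hA.exists_comp u (continuous_radialMul (C := 1)
      ((continuous_sinHump k).comp (continuous_id.add continuous_const)) fun t ht => ?_)
    rw [sinHump, abs_of_nonneg (sq_nonneg _)]
    linarith [Real.sin_sq_le_one (Real.pi * max (k : ℝ) (min (t + c) (k + 1)))]
  choose h hh using hpiece
  have hfloor : ∀ k x, (h k).1 x ≠ 0 → u.1 x ≠ 0 ∧ ⌊(√‖u.1 x‖)⁻¹ + c⌋ = k := by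
    intro k x hx
    rw [hh, ne_eq, radialMul_eq_zero, not_or] at hx
    exact ⟨hx.2, floor_eq_of_sinHump_ne_zero hx.1⟩
  set δ := ‖(T f).1 y‖ / 2 with hδ
  have hδ0 : 0 < δ := half_pos (norm_pos_iff.2 hy)
  obtain ⟨n, hn⟩ := exists_nat_gt (‖(T g).1‖ / δ)
  -- On a hump with `k ≤ n` one has `‖u‖ ^ (-1/2) ≤ n + 1`, whence this `ε`.
  obtain ⟨W, hW, hyW, hW0⟩ := exists_nhd_apply_eq_zero hA hbB hT hp hu
    (ε := ((n + 1 : ℝ)⁻¹) ^ 2) (by positivity)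
  have hsmall : ∀ k : ℤ, k ≤ n → ∀ z ∈ W, (T (h k)).1 z = 0 := by
    intro k hk
    refine hW0 _ fun x hx => ?_
    obtain ⟨hx0, hxk⟩ := hfloor k x hx
    have hs : 0 < √‖u.1 x‖ := Real.sqrt_pos.2 (norm_pos_iff.2 hx0)
    have h1 : (√‖u.1 x‖)⁻¹ ≤ n + 1 := by
      have h2 := Int.lt_floor_add_one ((√‖u.1 x‖)⁻¹ + c)
      rw [hxk] at h2
      have h3 : (k : ℝ) ≤ n := by exact_mod_cast hk
      linarith
    rw [← Real.sq_sqrt (norm_nonneg (u.1 x))]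
    gcongr
    exact inv_le_of_inv_le₀ hs h1
  obtain ⟨b, hby, hb0⟩ := exists_apply_ne_zero hbB T (U := W ∩ {z | δ < ‖(T f).1 z‖}) (y := y)
    (hW.inter (isOpen_lt continuous_const (T f).1.continuous.norm))
    ⟨hyW, half_lt_self (norm_pos_iff.2 hy)⟩
  -- Otherwise `b` is disjoint from all humps, hence from `f`, although `T b` and `T f` are both
  -- nonzero at `y`.
  obtain ⟨k, z, hzb, hzk⟩ : ∃ k z, (T b).1 z ≠ 0 ∧ (T (h k)).1 z ≠ 0 := by
    by_contra! hcon
    have hbh : ∀ k x, b.1 x = 0 ∨ (h k).1 x = 0 := fun k x => by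
      simpa using hS (T b) (T (h k)) (fun z => or_iff_not_imp_left.2 (hcon k z)) x
    refine (hT b f (fun x => ?_) y).elim hby hy
    refine (hbh ⌊(√‖u.1 x‖)⁻¹ + c⌋ x).imp_right fun hx => ?_
    rw [hh, radialMul_eq_zero, sinHump_floor] at hx
    rwa [hf, radialMul_eq_zero]
  obtain ⟨hzW, hzδ⟩ : z ∈ W ∩ {z | δ < ‖(T f).1 z‖} := by
    by_contra hz
    exact hzb (hb0 z hz)
  have hkn : (n : ℤ) < k := by
    by_contra! hk
    exact hzk (hsmall k hk z hzW)
  have hTg : (T g).1 z = (k : 𝕜) • (T f).1 z := by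
    have := (hT (g - (k : 𝕜) • f) (h k) (fun x => ?_) z).resolve_right hzk
    · simpa [sub_eq_zero] using this
    · rw [or_iff_not_imp_right]
      intro hx
      have := (hfloor k x hx).2
      simp [hg, hf, radialMul, this, mul_smul]
  have hle : (k : ℝ) * δ ≤ ‖(T g).1‖ := by
    calc (k : ℝ) * δ ≤ |(k : ℝ)| * ‖(T f).1 z‖ := by
          gcongr
          · exact le_abs_self _
          · exact hzδ.le
      _ = ‖(T g).1 z‖ := by rw [hTg, norm_smul, ← RCLike.ofReal_intCast (K := 𝕜), RCLike.norm_ofReal]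
      _ ≤ _ := (T g).1.norm_coe_le_norm z
  rw [div_lt_iff₀ hδ0] at hn
  have : (n : ℝ) < k := by exact_mod_cast hkn
  nlinarith

/-- If `u` tends to zero along the support ultrafilter of `y`, then `T u` vanishes at `y`. -/
lemma apply_eq_zero_of_tendsto [Nontrivial F] (hA : StableUnderComp A) (hbB : HasBumps B)
    (hT : PreservesDisjointness T) (hS : PreservesDisjointness T.symm)
    (hp : ∀ f : A, (T f).1 y ≠ 0 → closure (support f.1) ∈ p)
    (hu : Tendsto u.1 p (𝓝 0)) : (T u).1 y = 0 := by
  have key : ∀ c : ℝ, ∃ f : A, ∀ x, f.1 x =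
      radialMul 𝕜 (fun t => Real.sin (Real.pi * (t + c)) ^ 2) (u.1 x) := fun c =>
    hA.exists_comp u (continuous_radialMul (C := 1) (by fun_prop) fun t ht => by
      rw [abs_of_nonneg (sq_nonneg _)]
      linarith [Real.sin_sq_le_one (Real.pi * (t + c))])
  -- The shift by `1 / 2` turns `sin²` into `cos²`, so the two parts add up to `u`.
  obtain ⟨f, hf⟩ := key 0
  obtain ⟨g, hg⟩ := key (1 / 2)
  have hfg : u = f + g := by
    ext x
    have h1 : ∀ t : ℝ, Real.sin (Real.pi * (t + 0)) ^ 2 +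
        Real.sin (Real.pi * (t + 1 / 2)) ^ 2 = 1 := fun t => by
      rw [mul_add Real.pi t (1 / 2), mul_one_div, Real.sin_add_pi_div_two, add_zero,
        Real.sin_sq_add_cos_sq]
    simp only [Submodule.coe_add, BoundedContinuousFunction.coe_add, Pi.add_apply, hf, hg,
      radialMul]
    rw [← add_smul, ← RCLike.ofReal_add, h1]
    simp
  rw [hfg, map_add, Submodule.coe_add, BoundedContinuousFunction.coe_add, Pi.add_apply,
    hump_apply_eq_zero hA hbB hT hS hp hu le_rfl zero_le_one hf,
    hump_apply_eq_zero hA hbB hT hS hp hu (by norm_num) (by norm_num) hg, add_zero]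

/-- Evaluations of `T f` are controlled by a surjective operator from the finite-dimensional
space of values. -/
lemma exists_fiber_operator [FiniteDimensional 𝕜 E] [Nontrivial E] [Nontrivial F]
    (hA : StableUnderComp A) (hbA : HasBumps A) (hbB : HasBumps B)
    (hT : PreservesDisjointness T) (hS : PreservesDisjointness T.symm) (y : Y) :
    ∃ J : E →L[𝕜] F, Surjective J ∧ ∀ f : A, ‖(T f).1 y‖ ≤ ‖J‖ * ‖f‖ := by
  obtain ⟨p, hp⟩ := exists_ultrafilter hbA hbB hT hS y
  let J₀ : E →ₗ[𝕜] F :=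
    { toFun := fun e => (T ⟨_, hA.const_mem e⟩).1 y
      map_add' := fun a b => by
        rw [← Pi.add_apply, ← BoundedContinuousFunction.coe_add, ← Submodule.coe_add, ← map_add]
        rfl
      map_smul' := fun a b => by
        rw [RingHom.id_apply, ← BoundedContinuousFunction.smul_apply, ← Submodule.coe_smul,
          ← map_smul]
        rfl }
  have : ProperSpace E := FiniteDimensional.proper_rclike 𝕜 E
  have hlim : ∀ f : A, ∃ e : E, ‖e‖ ≤ ‖f‖ ∧ (T f).1 y = J₀ e := by
    intro f
    obtain ⟨e, he, hpe⟩ := (isCompact_closedBall (0 : E) ‖f‖).ultrafilter_le_nhds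
      (p.map f.1) (by
        rw [le_principal_iff, Ultrafilter.coe_map]
        refine mem_map.2 (Eventually.of_forall fun x => ?_)
        simpa using f.1.norm_coe_le_norm x)
    refine ⟨e, by simpa using he, ?_⟩
    have hte : Tendsto f.1 p (𝓝 e) := hpe
    have h0 := apply_eq_zero_of_tendsto (u := f - ⟨_, hA.const_mem e⟩) hA hbB hT hS hp (by
      rw [← sub_self e]
      exact hte.sub_const e)
    rw [map_sub] at h0
    exact sub_eq_zero.1 h0
  refine ⟨LinearMap.toContinuousLinearMap J₀, fun v => ?_, fun f => ?_⟩
  · obtain ⟨b, hb, -⟩ := hbB univ y v isOpen_univ (mem_univ y)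
    obtain ⟨e, -, he⟩ := hlim (T.symm b)
    refine ⟨e, ?_⟩
    rw [LinearEquiv.apply_symm_apply, hb] at he
    exact he.symm
  · obtain ⟨e, he, hfe⟩ := hlim f
    rw [hfe]
    exact (ContinuousLinearMap.le_opNorm (LinearMap.toContinuousLinearMap J₀) e).trans
      (by gcongr)

/-- Automatic continuity of linear biseparating bijections. -/
theorem continuous_of_preservesDisjointness [FiniteDimensional 𝕜 E]
    (hA : StableUnderComp A) (hbA : HasBumps A) (hbB : HasBumps B)
    (hAc : IsClosed (A : Set (X →ᵇ E))) (hBc : IsClosed (B : Set (Y →ᵇ F)))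
    (hT : PreservesDisjointness T) (hS : PreservesDisjointness T.symm) :
    Continuous T ∧ Continuous T.symm := by
  have hsub : Subsingleton A → Continuous T ∧ Continuous T.symm := fun _ => by
    have : Subsingleton B := T.symm.injective.subsingleton
    exact ⟨continuous_of_const fun a b => by rw [Subsingleton.elim a b],
      continuous_of_const fun a b => by rw [Subsingleton.elim a b]⟩
  rcases subsingleton_or_nontrivial E with _ | _
  · exact hsub ⟨fun a b => by ext x; exact Subsingleton.elim _ _⟩
  rcases isEmpty_or_nonempty Y with _ | ⟨⟨y₀⟩⟩
  · have : Subsingleton B := ⟨fun a b => by ext x; exact isEmptyElim x⟩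
    exact hsub T.injective.subsingleton
  rcases subsingleton_or_nontrivial F with _ | _
  · have : Subsingleton B := ⟨fun a b => by ext x; exact Subsingleton.elim _ _⟩
    exact hsub T.injective.subsingleton
  have hJ := exists_fiber_operator hA hbA hbB hT hS
  obtain ⟨J, hJs, -⟩ := hJ y₀
  have : FiniteDimensional 𝕜 F := Module.Finite.of_surjective J.toLinearMap hJs
  have : CompleteSpace E := FiniteDimensional.complete 𝕜 E
  have : CompleteSpace F := FiniteDimensional.complete 𝕜 F
  have : CompleteSpace A := hAc.completeSpace_coe
  have : CompleteSpace B := hBc.completeSpace_coe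
  -- The bound `‖J‖` depends on `y`, but pointwise continuity suffices to close the graph.
  have hcont : Continuous T := by
    refine LinearMap.continuous_of_seq_closed_graph (g := (T : A →ₗ[𝕜] B)) fun w a b hw hb => ?_
    ext y
    obtain ⟨J, -, hle⟩ := hJ y
    have h1 : Tendsto (fun i => (T (w i)).1 y) atTop (𝓝 (b.1 y)) :=
      ((continuous_eval_const (F := Y →ᵇ F) y).comp
        continuous_subtype_val).continuousAt.tendsto.comp hb
    have h2 : Tendsto (fun i => (T (w i)).1 y) atTop (𝓝 ((T a).1 y)) := by
      rw [tendsto_iff_norm_sub_tendsto_zero]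
      have h3 : Tendsto (fun i => ‖J‖ * ‖w i - a‖) atTop (𝓝 0) := by
        simpa using (tendsto_iff_norm_sub_tendsto_zero.1 hw).const_mul ‖J‖
      exact squeeze_zero (fun _ => norm_nonneg _)
        (fun i => by simpa using hle (w i - a)) h3
    exact tendsto_nhds_unique h1 h2
  exact ⟨hcont, T.continuous_symm hcont⟩

end General

/-! ### The two concrete function spaces -/

section Spaces

variable {𝕜 X Y E F : Type*} [RCLike 𝕜] [NormedAddCommGroup E] [NormedSpace 𝕜 E]
  [NormedAddCommGroup F] [NormedSpace 𝕜 F]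

lemma exists_bounded_comp [TopologicalSpace X] [ProperSpace E] (f g : X →ᵇ E) {G : E × E → E}
    (hG : Continuous G) : ∃ h : X →ᵇ E, ∀ x, h x = G (f x, g x) := by
  obtain ⟨C, hC⟩ := ((isCompact_closedBall (0 : E) ‖f‖).prod
    (isCompact_closedBall (0 : E) ‖g‖)).exists_bound_of_continuousOn hG.continuousOn
  refine ⟨BoundedContinuousFunction.ofNormedAddCommGroup (fun x => G (f x, g x))
    (by fun_prop) C fun x => hC _ ⟨?_, ?_⟩, fun x => rfl⟩
  · simpa using f.norm_coe_le_norm x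
  · simpa using g.norm_coe_le_norm x

lemma stableUnderComp_top [TopologicalSpace X] [FiniteDimensional 𝕜 E] :
    StableUnderComp (⊤ : Submodule 𝕜 (X →ᵇ E)) := by
  have : ProperSpace E := FiniteDimensional.proper_rclike 𝕜 E
  intro f g G hG
  obtain ⟨h, hh⟩ := exists_bounded_comp f.1 g.1 hG
  exact ⟨⟨h, trivial⟩, hh⟩

lemma stableUnderComp_cbu [MetricSpace X] [FiniteDimensional 𝕜 E] :
    StableUnderComp (Cbu 𝕜 X E) := by
  have : ProperSpace E := FiniteDimensional.proper_rclike 𝕜 E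
  intro f g G hG
  obtain ⟨h, hh⟩ := exists_bounded_comp f.1 g.1 hG
  refine ⟨⟨h, ?_⟩, hh⟩
  change UniformContinuous h
  -- The values of `(f, g)` stay in a compact set, on which `G` is uniformly continuous.
  have hK := ((isCompact_closedBall (0 : E) ‖f‖).prod
    (isCompact_closedBall (0 : E) ‖g‖)).uniformContinuousOn_of_continuous hG.continuousOn
  have hfg : UniformContinuous fun x => (f.1 x, g.1 x) :=
    UniformContinuous.prodMk (show UniformContinuous f.1 from f.2)
      (show UniformContinuous g.1 from g.2)
  have := hK.comp hfg.uniformContinuousOn (s := univ) fun x _ =>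
    ⟨by simpa using f.1.norm_coe_le_norm x, by simpa using g.1.norm_coe_le_norm x⟩
  rw [uniformContinuousOn_univ] at this
  convert this using 1
  ext x
  exact hh x

lemma norm_ofReal_smul_le {r : ℝ} (h0 : 0 ≤ r) (h1 : r ≤ 1) (v : E) :
    ‖((r : ℝ) : 𝕜) • v‖ ≤ ‖v‖ := by
  rw [norm_smul, RCLike.norm_ofReal, abs_of_nonneg h0]
  exact mul_le_of_le_one_left (norm_nonneg v) h1

lemma hasBumps_top [TopologicalSpace X] [CompletelyRegularSpace X] :
    HasBumps (⊤ : Submodule 𝕜 (X →ᵇ E)) := by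
  intro U x v hU hx
  obtain ⟨φ, hφ, hφx, hφU⟩ := CompletelyRegularSpace.completely_regular x Uᶜ hU.isClosed_compl
    (by simpa using hx)
  refine ⟨⟨BoundedContinuousFunction.ofNormedAddCommGroup
    (fun z => ((1 - φ z : ℝ) : 𝕜) • v)
    ((RCLike.continuous_ofReal.comp (by fun_prop)).smul continuous_const) ‖v‖
    fun z => norm_ofReal_smul_le (sub_nonneg.2 (φ z).2.2) (by linarith [(φ z).2.1]) v,
    trivial⟩, ?_, fun z hz => ?_⟩
  · simp [hφx]
  · have : φ z = 1 := hφU hz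
    simp [this]

lemma hasBumps_cbu [MetricSpace X] : HasBumps (Cbu 𝕜 X E) := by
  intro U x v hU hx
  obtain ⟨ε, hε, hεU⟩ := Metric.isOpen_iff.1 hU x hx
  set φ : X → ℝ := fun z => max 0 (1 - ε⁻¹ * dist z x) with hφ
  have huc : UniformContinuous fun z => ((φ z : ℝ) : 𝕜) • v := by
    have h1 : LipschitzWith 1 fun z => dist z x := LipschitzWith.dist_left x
    have h2 : UniformContinuous φ :=
      ((LipschitzWith.id.const_max 0).uniformContinuous).comp (uniformContinuous_const.sub
        (h1.uniformContinuous.const_mul' ε⁻¹))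
    have h3 : UniformContinuous fun r : ℝ => ((r : ℝ) : 𝕜) • v :=
      ((ContinuousLinearMap.toSpanSingleton 𝕜 v).uniformContinuous).comp
        (RCLike.ofRealCLM (K := 𝕜)).uniformContinuous
    exact h3.comp h2
  refine ⟨⟨BoundedContinuousFunction.ofNormedAddCommGroup _ huc.continuous ‖v‖
    fun z => norm_ofReal_smul_le (le_max_left _ _) (max_le zero_le_one ?_) v, huc⟩,
    ?_, fun z hz => ?_⟩
  · linarith [show 0 ≤ ε⁻¹ * dist z x by positivity]
  · simp [hφ]
  · have h1 : ε ≤ dist z x := by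
      by_contra! h
      exact hz (hεU h)
    have h2 : 1 ≤ ε⁻¹ * dist z x := by
      rw [inv_mul_eq_div, one_le_div hε]; exact h1
    simp [hφ, max_eq_left (sub_nonpos.2 h2)]

lemma isClosed_cbu [MetricSpace X] : IsClosed (Cbu 𝕜 X E : Set (X →ᵇ E)) := by
  refine isClosed_of_closure_subset fun f hf => ?_
  obtain ⟨w, hw, hlim⟩ := mem_closure_iff_seq_limit.1 hf
  exact (BoundedContinuousFunction.tendsto_iff_tendstoUniformly.1 hlim).uniformContinuous
    (Frequently.of_forall hw)

end Spaces

end SepMaps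

open SepMaps in
theorem corollary2p8 {𝕜 E F : Type*} [RCLike 𝕜]
    [NormedAddCommGroup E] [NormedSpace 𝕜 E] [FiniteDimensional 𝕜 E]
    [NormedAddCommGroup F] [NormedSpace 𝕜 F] :
    (∀ (X Y : Type*) [TopologicalSpace X] [CompletelyRegularSpace X]
        [TopologicalSpace Y] [CompletelyRegularSpace Y]
        (T : (X →ᵇ E) ≃ₗ[𝕜] (Y →ᵇ F)),
        SepMaps.IsBiseparating T.toEquiv → Continuous T ∧ Continuous T.symm) ∧
    (∀ (X Y : Type*) [MetricSpace X] [CompleteSpace X] [MetricSpace Y] [CompleteSpace Y]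
        (T : SepMaps.Cbu 𝕜 X E ≃ₗ[𝕜] SepMaps.Cbu 𝕜 Y F),
        SepMaps.IsBiseparating T.toEquiv → Continuous T ∧ Continuous T.symm) := by
  refine ⟨fun X Y _ _ _ _ T hT => ?_, fun X Y _ _ _ _ T hT => ?_⟩
  · let T' : (⊤ : Submodule 𝕜 (X →ᵇ E)) ≃ₗ[𝕜] (⊤ : Submodule 𝕜 (Y →ᵇ F)) :=
      (Submodule.topEquiv.trans T).trans Submodule.topEquiv.symm
    obtain ⟨h1, h2⟩ := continuous_of_preservesDisjointness (T := T') stableUnderComp_top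
      hasBumps_top hasBumps_top isClosed_univ isClosed_univ
      (fun f g hfg => disjoint_support_iff_forall.1
        (hT.1.2 f.1 g.1 (disjoint_support_iff_forall.2 hfg)))
      (fun f g hfg => disjoint_support_iff_forall.1
        (hT.2.2 f.1 g.1 (disjoint_support_iff_forall.2 hfg)))
    exact ⟨continuous_subtype_val.comp (h1.comp (continuous_id.subtype_mk fun _ => trivial)),
      continuous_subtype_val.comp (h2.comp (continuous_id.subtype_mk fun _ => trivial))⟩
  · exact continuous_of_preservesDisjointness stableUnderComp_cbu hasBumps_cbu hasBumps_cbu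
      isClosed_cbu isClosed_cbu
      (fun f g hfg => disjoint_support_iff_forall.1
        (hT.1.2 f g (disjoint_support_iff_forall.2 hfg)))
      (fun f g hfg => disjoint_support_iff_forall.1
        (hT.2.2 f g (disjoint_support_iff_forall.2 hfg)))
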